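/- **Conventions.** Let $M$ be a smooth (Hausdorff) manifold of dimension $4n+3$ with $n\ge 1$, equipped with a Riemannian metric $g$ and three almost contact structures $(\varphi_i,\xi_i,\eta_i)$, $i=1,2,3$ (so $\varphi_i^2=-I+\eta_i\otimes\xi_i$, $\eta_i(\xi_i)=1$), each compatible with $g$ (so $g(\varphi_iX,\varphi_iY)=g(X,Y)-\eta_i(X)\eta_i(Y)$), which form an *almost $3$-contact metric structure*: for every even permutation $(i,j,k)$ of $(1,2,3)$, $$\varphi_k=\varphi_i\varphi_j-\eta_j\otimes\xi_i=-\varphi_j\varphi_i+\eta_i\otimes\xi_j,\quad \xi_k=\varphi_i\xi_j=-\varphi_j\xi_i,\quad \eta_k=\eta_i\circ\varphi_j=-\eta_j\circ\varphi_i .$$ Put $\mathcal H=\bigcap_i\ker\eta_i$ and $\Phi_i(X,Y)=g(X,\varphi_iY)$. Exterior derivatives and wedge products are taken without numerical factors: $d\eta(X,Y)=X\eta(Y)-Y\eta(X)-\eta([X,Y])$, likewise for $d\Phi_i$, and $(\eta\wedge\Phi)(X,Y,Z)=\eta(X)\Phi(Y,Z)+\eta(Y)\Phi(Z,X)+\eta(Z)\Phi(X,Y)$.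 Let $$N_{\varphi_i}(X,Y)=[\varphi_iX,\varphi_iY]+\varphi_i^2[X,Y]-\varphi_i[\varphi_iX,Y]-\varphi_i[X,\varphi_iY]+d\eta_i(X,Y)\xi_i,$$ $N_{\varphi_i}(X,Y,Z)=g(N_{\varphi_i}(X,Y),Z)$, and for $X,Y\in\Gamma(\mathcal H)$ $$A_{ij}(X,Y)=g((\mathcal L_{\xi_j}\varphi_i)X,Y)+d\eta_j(X,\varphi_iY)+d\eta_j(\varphi_iX,Y).$$ A *Reeb Killing function* is a function $\beta\in C^\infty(M)$ such that $A_{ii}=0$ and $A_{ij}=-A_{ji}=\beta\,\Phi_k$ on $\mathcal H$ for every even permutation $(i,j,k)$ of $(1,2,3)$. The manifold is *canonical* if each $N_{\varphi_i}(X,Y,Z)$ is totally skew-symmetric on $\mathcal H$, each $\xi_i$ is Killing, $N_{\varphi_i}(X,Y,Z)-d\Phi_i(\varphi_iX,\varphi_iY,\varphi_iZ)$ does not depend on $i$ for $X,Y,Z\in\Gamma(\mathcal H)$, and $M$ admits a Reeb Killing function. A metric connection *has skew torsion* if $T(X,Y,Z)=g(T(X,Y),Z)$ is a $3$-form. The *characteristic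 connection* $\nabla^i$ of $(\varphi_i,\xi_i,\eta_i,g)$ is the metric connection with skew torsion such that $\nabla^i\eta_i=0$ and $\nabla^i\varphi_i=0$. The *canonical connection* $\nabla$ is the metric connection with skew torsion such that, for some smooth function $\tilde\beta$, $\nabla_X\varphi_i=\tilde\beta(\eta_k(X)\varphi_j-\eta_j(X)\varphi_k)$ for all vector fields $X$ and every even permutation $(i,j,k)$ of $(1,2,3)$. **Theorem.** Let $(M,\varphi_i,\xi_i,\eta_i,g)$ be a canonical almost $3$-contact metric manifold of dimension $4n+3$, $n\ge1$, with Reeb Killing function $\beta$, let $\nabla$ be its canonical connection, with torsion $T$, and let $\nabla^i$ $(i=1,2,3)$ be the characteristic connections of $(\varphi_i,\xi_i,\eta_i,g)$, with torsions $T_i$. Then for every even permutation $(i,j,k)$ of $(1,2,3)$ $$\nabla=\nabla^i-\frac{\beta}{2}(\eta_j\wedge\Phi_j+\eta_k\wedge\Phi_k),$$ that is, $g(\nabla_XY,Z)=g(\nabla^i_XY,Z)-\frac{\beta}{2}(\eta_j\wedge\Phi_j+\eta_k\wedge\Phi_k)(X,Y,Z)$ for all vector fields $X,Y,Z$; and $$T-T_i=-\beta(\eta_j\wedge\Phi_j+\eta_k\wedge\Phi_k).$$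 In particular, if $\beta=0$, then $\nabla^1=\nabla^2=\nabla^3=\nabla$. -/

import Mathlib

open Bundle
open scoped Manifold ContDiff

noncomputable section

namespace AlmostContact

section VectorFields

variable {d : ℕ} {M : Type*} [TopologicalSpace M] [ChartedSpace (EuclideanSpace ℝ (Fin d)) M]

/-- `X` is a smooth global vector field. -/
def IsSmoothField [IsManifold (𝓡 d) ∞ M] (X : ∀ x : M, TangentSpace (𝓡 d) x) : Prop :=
  ContMDiff (𝓡 d) (𝓡 d).tangent ∞
    (fun x ↦ (TotalSpace.mk' (EuclideanSpace ℝ (Fin d)) x (X x) : TangentBundle (𝓡 d) M))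

/-- The exterior derivative of a 1-form, with the convention
`dη(X, Y) = X(η(Y)) - Y(η(X)) - η([X, Y])`. -/
def extDeriv₁ (η : ∀ x : M, TangentSpace (𝓡 d) x →L[ℝ] ℝ)
    (X Y : ∀ x : M, TangentSpace (𝓡 d) x) (x : M) : ℝ :=
  mvfderiv (𝓡 d) (fun y ↦ η y (Y y)) x (X x) - mvfderiv (𝓡 d) (fun y ↦ η y (X y)) x (Y x)
    - η x (VectorField.mlieBracket (𝓡 d) X Y x)

/-- The exterior derivative of a 2-form, with the convention
`dΦ(X, Y, Z) = X(Φ(Y, Z)) + Y(Φ(Z, X)) + Z(Φ(X, Y)) - Φ([X, Y], Z) - Φ([Y, Z], X) - Φ([Z, X], Y)`. -/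
def extDeriv₂ (Φ : ∀ x : M, TangentSpace (𝓡 d) x → TangentSpace (𝓡 d) x → ℝ)
    (X Y Z : ∀ x : M, TangentSpace (𝓡 d) x) (x : M) : ℝ :=
  mvfderiv (𝓡 d) (fun y ↦ Φ y (Y y) (Z y)) x (X x)
    + mvfderiv (𝓡 d) (fun y ↦ Φ y (Z y) (X y)) x (Y x)
    + mvfderiv (𝓡 d) (fun y ↦ Φ y (X y) (Y y)) x (Z x)
    - Φ x (VectorField.mlieBracket (𝓡 d) X Y x) (Z x)
    - Φ x (VectorField.mlieBracket (𝓡 d) Y Z x) (X x)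
    - Φ x (VectorField.mlieBracket (𝓡 d) Z X x) (Y x)

/-- The wedge product `η ∧ Φ` of a 1-form and a 2-form, evaluated on three tangent vectors. -/
def wedge₁₂ {V : Type*} (η : V → ℝ) (Φ : V → V → ℝ) (u v w : V) : ℝ :=
  η u * Φ v w + η v * Φ w u + η w * Φ u v

/-- The Lie derivative `(𝓛_ξ φ) X = [ξ, φ X] - φ [ξ, X]` of an endomorphism field. -/
def lieDerivEndo (ξ : ∀ x : M, TangentSpace (𝓡 d) x)
    (φ : ∀ x : M, TangentSpace (𝓡 d) x →L[ℝ] TangentSpace (𝓡 d) x)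
    (X : ∀ x : M, TangentSpace (𝓡 d) x) (x : M) : TangentSpace (𝓡 d) x :=
  VectorField.mlieBracket (𝓡 d) ξ (fun y ↦ φ y (X y)) x
    - φ x (VectorField.mlieBracket (𝓡 d) ξ X x)

variable [IsManifold (𝓡 d) ∞ M]

/-- `(∇_X φ) Y = ∇_X (φ Y) - φ (∇_X Y)`. Note that `D Y x (X x)` stands for `(∇_X Y)(x)`. -/
def covDerivEndo (D : CovariantDerivative (𝓡 d) (EuclideanSpace ℝ (Fin d))
      (TangentSpace (𝓡 d) : M → Type _))
    (φ : ∀ x : M, TangentSpace (𝓡 d) x →L[ℝ] TangentSpace (𝓡 d) x)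
    (X Y : ∀ x : M, TangentSpace (𝓡 d) x) (x : M) : TangentSpace (𝓡 d) x :=
  D (fun y ↦ φ y (Y y)) x (X x) - φ x (D Y x (X x))

/-- `(∇_X η)(Y) = X(η(Y)) - η(∇_X Y)`. -/
def covDerivForm (D : CovariantDerivative (𝓡 d) (EuclideanSpace ℝ (Fin d))
      (TangentSpace (𝓡 d) : M → Type _))
    (η : ∀ x : M, TangentSpace (𝓡 d) x →L[ℝ] ℝ)
    (X Y : ∀ x : M, TangentSpace (𝓡 d) x) (x : M) : ℝ :=
  mvfderiv (𝓡 d) (fun y ↦ η y (Y y)) x (X x) - η x (D Y x (X x))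

end VectorFields

section Structures

variable (d : ℕ) (M : Type*) [TopologicalSpace M] [ChartedSpace (EuclideanSpace ℝ (Fin d)) M]
  [IsManifold (𝓡 d) ∞ M]

/-- An almost contact structure `(φ, ξ, η)`: a smooth `(1,1)`-tensor field, a smooth vector field
and a smooth 1-form with `φ² = -I + η ⊗ ξ` and `η(ξ) = 1`. -/
structure AlmostContactStructure where
  φ : ∀ x : M, TangentSpace (𝓡 d) x →L[ℝ] TangentSpace (𝓡 d) x
  ξ : ∀ x : M, TangentSpace (𝓡 d) x
  η : ∀ x : M, TangentSpace (𝓡 d) x →L[ℝ] ℝ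
  smooth_φ : ContMDiff (𝓡 d)
    ((𝓡 d).prod 𝓘(ℝ, EuclideanSpace ℝ (Fin d) →L[ℝ] EuclideanSpace ℝ (Fin d))) ∞
    (fun x ↦ TotalSpace.mk' (EuclideanSpace ℝ (Fin d) →L[ℝ] EuclideanSpace ℝ (Fin d))
      (E := fun x : M ↦ TangentSpace (𝓡 d) x →L[ℝ] TangentSpace (𝓡 d) x) x (φ x))
  smooth_ξ : IsSmoothField ξ
  smooth_η : ContMDiff (𝓡 d) ((𝓡 d).prod 𝓘(ℝ, EuclideanSpace ℝ (Fin d) →L[ℝ] ℝ)) ∞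
    (fun x ↦ TotalSpace.mk' (EuclideanSpace ℝ (Fin d) →L[ℝ] ℝ)
      (E := fun x : M ↦ TangentSpace (𝓡 d) x →L[ℝ] Bundle.Trivial M ℝ x) x (η x))
  φ_sq : ∀ (x : M) (v : TangentSpace (𝓡 d) x), φ x (φ x v) = -v + η x v • ξ x
  η_ξ : ∀ x : M, η x (ξ x) = 1

variable {d M}

/-- `N_φ(X, Y) = [φX, φY] + φ²[X, Y] - φ[φX, Y] - φ[X, φY] + dη(X, Y) ξ`. -/
def AlmostContactStructure.nijenhuis (s : AlmostContactStructure d M)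
    (X Y : ∀ x : M, TangentSpace (𝓡 d) x) (x : M) : TangentSpace (𝓡 d) x :=
  VectorField.mlieBracket (𝓡 d) (fun y ↦ s.φ y (X y)) (fun y ↦ s.φ y (Y y)) x
    + s.φ x (s.φ x (VectorField.mlieBracket (𝓡 d) X Y x))
    - s.φ x (VectorField.mlieBracket (𝓡 d) (fun y ↦ s.φ y (X y)) Y x)
    - s.φ x (VectorField.mlieBracket (𝓡 d) X (fun y ↦ s.φ y (Y y)) x)
    + extDeriv₁ s.η X Y x • s.ξ x

end Structures

section Metric

variable {d : ℕ} {M : Type*} [TopologicalSpace M] [ChartedSpace (EuclideanSpace ℝ (Fin d)) M]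
  [IsManifold (𝓡 d) ∞ M]
  [RiemannianBundle (fun x : M ↦ TangentSpace (𝓡 d) x)]

/-- The Riemannian metric `g` is compatible with `(φ, ξ, η)`:
`g(φX, φY) = g(X, Y) - η(X) η(Y)`. -/
def AlmostContactStructure.IsCompatible (s : AlmostContactStructure d M) : Prop :=
  ∀ (x : M) (u v : TangentSpace (𝓡 d) x),
    inner ℝ (s.φ x u) (s.φ x v) = inner ℝ u v - s.η x u * s.η x v

/-- The fundamental 2-form `Φ(X, Y) = g(X, φY)`. -/
def AlmostContactStructure.fundForm (s : AlmostContactStructure d M) (x : M)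
    (u v : TangentSpace (𝓡 d) x) : ℝ :=
  inner ℝ u (s.φ x v)

/-- `ξ` is a Killing vector field: `(𝓛_ξ g)(X, Y) = ξ(g(X, Y)) - g([ξ, X], Y) - g(X, [ξ, Y])`
vanishes for all smooth vector fields `X`, `Y`. -/
def IsKilling (ξ : ∀ x : M, TangentSpace (𝓡 d) x) : Prop :=
  ∀ X Y : ∀ x : M, TangentSpace (𝓡 d) x, IsSmoothField X → IsSmoothField Y → ∀ x : M,
    mvfderiv (𝓡 d) (fun y ↦ (inner ℝ (X y) (Y y) : ℝ)) x (ξ x)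
      - inner ℝ (VectorField.mlieBracket (𝓡 d) ξ X x) (Y x)
      - inner ℝ (X x) (VectorField.mlieBracket (𝓡 d) ξ Y x) = 0

/-- The torsion `T(X, Y, Z) = g(T(X, Y), Z)` of a linear connection as a `(0,3)`-tensor. -/
def torsionForm (D : CovariantDerivative (𝓡 d) (EuclideanSpace ℝ (Fin d))
      (TangentSpace (𝓡 d) : M → Type _)) (x : M) (u v w : TangentSpace (𝓡 d) x) : ℝ :=
  inner ℝ (D.torsion x u v) w

variable [IsContMDiffRiemannianBundle (𝓡 d) ∞ (EuclideanSpace ℝ (Fin d))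
    (fun x : M ↦ TangentSpace (𝓡 d) x)]

set_option synthInstance.maxHeartbeats 200000 in
/-- A smooth linear connection which is metric (`∇g = 0`) and whose torsion is a 3-form. -/
structure IsMetricWithSkewTorsion
    (D : CovariantDerivative (𝓡 d) (EuclideanSpace ℝ (Fin d))
      (TangentSpace (𝓡 d) : M → Type _)) : Prop where
  smooth : ContMDiffCovariantDerivativeOn (EuclideanSpace ℝ (Fin d)) ∞ D.toFun Set.univ
  metric : D.IsMetricCompatible
  skew₁₂ : ∀ (x : M) (u v w : TangentSpace (𝓡 d) x), torsionForm D x u v w = -torsionForm D x v u w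
  skew₂₃ : ∀ (x : M) (u v w : TangentSpace (𝓡 d) x), torsionForm D x u v w = -torsionForm D x u w v

/-- `D` is the characteristic connection of the almost contact metric structure `(φ, ξ, η, g)`:
the metric connection with skew torsion such that `∇η = 0` and `∇φ = 0`. -/
structure AlmostContactStructure.IsCharacteristicConnection (s : AlmostContactStructure d M)
    (D : CovariantDerivative (𝓡 d) (EuclideanSpace ℝ (Fin d))
      (TangentSpace (𝓡 d) : M → Type _)) : Prop extends IsMetricWithSkewTorsion D where
  parallel_η : ∀ X Y : ∀ x : M, TangentSpace (𝓡 d) x, IsSmoothField X → IsSmoothField Y →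
    ∀ x : M, covDerivForm D s.η X Y x = 0
  parallel_φ : ∀ X Y : ∀ x : M, TangentSpace (𝓡 d) x, IsSmoothField X → IsSmoothField Y →
    ∀ x : M, covDerivEndo D s.φ X Y x = 0

end Metric

section ThreeStructures

variable (n : ℕ) (M : Type*) [TopologicalSpace M]
  [ChartedSpace (EuclideanSpace ℝ (Fin (4 * n + 3))) M] [IsManifold (𝓡 (4 * n + 3)) ∞ M]
  [RiemannianBundle (fun x : M ↦ TangentSpace (𝓡 (4 * n + 3)) x)]

/-- An almost 3-contact metric structure on a Riemannian manifold `(M, g)` of dimension `4n + 3`.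
The index set `{1, 2, 3}` is `Fin 3`, whose addition is cyclic, so the even permutations
`(i, j, k)` are exactly the triples `(i, i + 1, i + 2)`. -/
structure AlmostThreeContactMetric where
  str : Fin 3 → AlmostContactStructure (4 * n + 3) M
  compatible : ∀ i, (str i).IsCompatible
  φ_eq : ∀ (i : Fin 3) (x : M) (v : TangentSpace (𝓡 (4 * n + 3)) x),
    (str (i + 2)).φ x v
      = (str i).φ x ((str (i + 1)).φ x v) - (str (i + 1)).η x v • (str i).ξ x
  φ_eq' : ∀ (i : Fin 3) (x : M) (v : TangentSpace (𝓡 (4 * n + 3)) x),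
    (str (i + 2)).φ x v
      = -(str (i + 1)).φ x ((str i).φ x v) + (str i).η x v • (str (i + 1)).ξ x
  ξ_eq : ∀ (i : Fin 3) (x : M), (str (i + 2)).ξ x = (str i).φ x ((str (i + 1)).ξ x)
  ξ_eq' : ∀ (i : Fin 3) (x : M), (str (i + 2)).ξ x = -(str (i + 1)).φ x ((str i).ξ x)
  η_eq : ∀ (i : Fin 3) (x : M) (v : TangentSpace (𝓡 (4 * n + 3)) x),
    (str (i + 2)).η x v = (str i).η x ((str (i + 1)).φ x v)
  η_eq' : ∀ (i : Fin 3) (x : M) (v : TangentSpace (𝓡 (4 * n + 3)) x),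
    (str (i + 2)).η x v = -(str (i + 1)).η x ((str i).φ x v)

namespace AlmostThreeContactMetric

variable {n M}
variable (S : AlmostThreeContactMetric n M)

/-- `X` is a smooth section of the horizontal distribution `H = ker η₁ ∩ ker η₂ ∩ ker η₃`. -/
def IsHorizontal (X : ∀ x : M, TangentSpace (𝓡 (4 * n + 3)) x) : Prop :=
  IsSmoothField X ∧ ∀ (i : Fin 3) (x : M), (S.str i).η x (X x) = 0

/-- `A_{ij}(X, Y) = g((𝓛_{ξ_j} φ_i) X, Y) + dη_j(X, φ_i Y) + dη_j(φ_i X, Y)`. -/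
def tensorA (i j : Fin 3) (X Y : ∀ x : M, TangentSpace (𝓡 (4 * n + 3)) x) (x : M) : ℝ :=
  inner ℝ (lieDerivEndo (S.str j).ξ (S.str i).φ X x) (Y x)
    + extDeriv₁ (S.str j).η X (fun y ↦ (S.str i).φ y (Y y)) x
    + extDeriv₁ (S.str j).η (fun y ↦ (S.str i).φ y (X y)) Y x

/-- `β` is a Reeb Killing function: it is smooth and, for horizontal `X`, `Y` and every even
permutation `(i, j, k)`, `A_{ii}(X, Y) = 0` and `A_{ij}(X, Y) = -A_{ji}(X, Y) = β Φ_k(X, Y)`. -/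
structure IsReebKillingFunction (β : M → ℝ) : Prop where
  smooth : ContMDiff (𝓡 (4 * n + 3)) 𝓘(ℝ, ℝ) ∞ β
  diag : ∀ (i : Fin 3) (X Y : ∀ x : M, TangentSpace (𝓡 (4 * n + 3)) x),
    S.IsHorizontal X → S.IsHorizontal Y → ∀ x : M, S.tensorA i i X Y x = 0
  offDiag : ∀ (i : Fin 3) (X Y : ∀ x : M, TangentSpace (𝓡 (4 * n + 3)) x),
    S.IsHorizontal X → S.IsHorizontal Y → ∀ x : M,
      S.tensorA i (i + 1) X Y x = β x * (S.str (i + 2)).fundForm x (X x) (Y x) ∧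
      -S.tensorA (i + 1) i X Y x = β x * (S.str (i + 2)).fundForm x (X x) (Y x)

/-- The `(0,3)`-tensor `N_{φ_i}(X, Y, Z) = g(N_{φ_i}(X, Y), Z)`. -/
def nijenhuisForm (i : Fin 3) (X Y Z : ∀ x : M, TangentSpace (𝓡 (4 * n + 3)) x) (x : M) : ℝ :=
  inner ℝ ((S.str i).nijenhuis X Y x) (Z x)

/-- `N_{φ_i}(X, Y, Z) - dΦ_i(φ_i X, φ_i Y, φ_i Z)`. -/
def horizontalTorsion (i : Fin 3) (X Y Z : ∀ x : M, TangentSpace (𝓡 (4 * n + 3)) x) (x : M) : ℝ :=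
  S.nijenhuisForm i X Y Z x
    - extDeriv₂ (S.str i).fundForm (fun y ↦ (S.str i).φ y (X y)) (fun y ↦ (S.str i).φ y (Y y))
        (fun y ↦ (S.str i).φ y (Z y)) x

/-- Canonical almost 3-contact metric manifolds. The tensor `N_{φ_i}(X, Y)` is always
skew-symmetric in `X`, `Y`; skew-symmetry on `H` is that of the associated `(0,3)`-tensor. -/
structure IsCanonical : Prop where
  nijenhuis_skew₁₂ : ∀ (i : Fin 3) (X Y Z : ∀ x : M, TangentSpace (𝓡 (4 * n + 3)) x),
    S.IsHorizontal X → S.IsHorizontal Y → S.IsHorizontal Z → ∀ x : M,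
      S.nijenhuisForm i X Y Z x = -S.nijenhuisForm i Y X Z x
  nijenhuis_skew₂₃ : ∀ (i : Fin 3) (X Y Z : ∀ x : M, TangentSpace (𝓡 (4 * n + 3)) x),
    S.IsHorizontal X → S.IsHorizontal Y → S.IsHorizontal Z → ∀ x : M,
      S.nijenhuisForm i X Y Z x = -S.nijenhuisForm i X Z Y x
  killing : ∀ i : Fin 3, IsKilling (S.str i).ξ
  horizontalTorsion_eq : ∀ (i j : Fin 3) (X Y Z : ∀ x : M, TangentSpace (𝓡 (4 * n + 3)) x),
    S.IsHorizontal X → S.IsHorizontal Y → S.IsHorizontal Z → ∀ x : M,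
      S.horizontalTorsion i X Y Z x = S.horizontalTorsion j X Y Z x
  exists_reebKilling : ∃ β : M → ℝ, S.IsReebKillingFunction β

/-- `D` is the canonical connection: the metric connection with skew torsion such that, for some
smooth function `b`, `∇_X φ_i = b (η_k(X) φ_j - η_j(X) φ_k)` for every vector field `X` and every
even permutation `(i, j, k)`. -/
structure IsCanonicalConnection
    [IsContMDiffRiemannianBundle (𝓡 (4 * n + 3)) ∞ (EuclideanSpace ℝ (Fin (4 * n + 3)))
      (fun x : M ↦ TangentSpace (𝓡 (4 * n + 3)) x)]
    (D : CovariantDerivative (𝓡 (4 * n + 3)) (EuclideanSpace ℝ (Fin (4 * n + 3)))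
      (TangentSpace (𝓡 (4 * n + 3)) : M → Type _)) : Prop
    extends IsMetricWithSkewTorsion D where
  exists_deriv_φ : ∃ b : M → ℝ, ContMDiff (𝓡 (4 * n + 3)) 𝓘(ℝ, ℝ) ∞ b ∧
    ∀ (i : Fin 3) (X Y : ∀ x : M, TangentSpace (𝓡 (4 * n + 3)) x),
      IsSmoothField X → IsSmoothField Y → ∀ x : M,
        covDerivEndo D (S.str i).φ X Y x
          = b x • ((S.str (i + 2)).η x (X x) • (S.str (i + 1)).φ x (Y x)
              - (S.str (i + 1)).η x (X x) • (S.str (i + 2)).φ x (Y x))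

/-- The 3-form `η_j ∧ Φ_j + η_k ∧ Φ_k` for the even permutation `(i, j, k)` starting with `i`. -/
def wedgeSum (i : Fin 3) (x : M) (u v w : TangentSpace (𝓡 (4 * n + 3)) x) : ℝ :=
  wedge₁₂ ((S.str (i + 1)).η x) ((S.str (i + 1)).fundForm x) u v w
    + wedge₁₂ ((S.str (i + 2)).η x) ((S.str (i + 2)).fundForm x) u v w

end AlmostThreeContactMetric

end ThreeStructures

end AlmostContact

end

/-! Two metric connections with skew torsion differ by a 3-form, equal to half the difference of
their torsions. Let $B=g(\nabla-\nabla^i)$ be this form. Since $\nabla^i\varphi_i=0$, letting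
$\varphi_i$ act as a derivation on the last two arguments of $B$ gives $g((\nabla_X\varphi_i)Y,Z)$,
which the defining property of $\nabla$ expresses through $\tilde\beta$, $\eta_j$, $\eta_k$,
$\varphi_j$, $\varphi_k$. Up to the factor $-\beta/2$, the form
$\eta_j\wedge\Phi_j+\eta_k\wedge\Phi_k$ has the same image under this action once
$\tilde\beta=\beta$ (`wedgeSum_φ`). The action is injective on 3-forms (`threeForm_eq_zero`), so $B$
is determined.

It remains to see that $\tilde\beta=\beta$ (`reebKilling_eq`). Written with any metric connection
with skew torsion, $A_{ij}$ contains no torsion (`tensorA_eq`). For $\nabla$ the Reeb fields are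
parallel in horizontal directions (`covDeriv_ξ_eq_zero`), so on $\mathcal H$ only
$g((\nabla_{\xi_j}\varphi_i)X,Y)=\tilde\beta\,\Phi_k(X,Y)$ survives. A nonzero horizontal vector,
available because $n\ge1$, then separates $\tilde\beta$ from any other value. -/

namespace AlmostContact

/-! ### Linear algebra of 3-forms under an almost contact endomorphism. -/

section Algebra

variable {V : Type*} [AddCommGroup V] [Module ℝ V]

/-- A trilinear form that is alternating in its first two and last two arguments and is annihilated
by `φ` acting as a derivation on the last two arguments vanishes, if `φ² = -I + η ⊗ ξ`. -/
theorem threeForm_eq_zero {φ : V → V} {η : V → ℝ} {ξ : V} (C : V → V → V → ℝ)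
    (hadd : ∀ u u' v w, C (u + u') v w = C u v w + C u' v w)
    (hsmul : ∀ (a : ℝ) u v w, C (a • u) v w = a * C u v w)
    (h₁₂ : ∀ u v w, C u v w = -C v u w) (h₂₃ : ∀ u v w, C u v w = -C u w v)
    (hφ : ∀ v, φ (φ v) = -v + η v • ξ)
    (hC : ∀ u v w, C u (φ v) w + C u v (φ w) = 0) (u v w : V) : C u v w = 0 := by
  -- By skew-symmetry, moving `φ` from any slot to any other changes the sign. Going once around the
  -- three slots gives three sign changes, so the value equals its own negative.
  have hker (u v w) : C (φ u) v w = 0 := by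
    linarith [hC w u v, hC v u w, hC u v w, h₁₂ (φ u) v w, h₂₃ v (φ u) w, h₂₃ v w (φ u),
      h₁₂ w (φ u) v, h₁₂ v w (φ u), h₁₂ u v (φ w), h₂₃ u (φ v) w, h₂₃ v u (φ w), h₁₂ w u (φ v),
      h₂₃ u w (φ v), h₁₂ u w (φ v), h₁₂ (φ v) u w, h₂₃ w (φ u) v]
  -- Applied to `φ u`, the vanishing above replaces `u` by its `ξ`-component. Doing this in two
  -- slots leaves `C ξ ξ w`, which is zero.
  have hred (u v w) : C u v w = η u * C ξ v w := by
    have h := hker (φ u) v w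
    rw [hφ, hadd, hsmul, ← neg_one_smul ℝ u, hsmul] at h
    linarith
  have hξ : C ξ ξ w = 0 := by linarith [h₁₂ ξ ξ w]
  rw [hred, h₁₂, hred, hξ]
  simp

end Algebra

/-! ### Almost contact identities and global extension of tangent vectors. -/

section Contact

variable {d : ℕ} {M : Type*} [TopologicalSpace M] [ChartedSpace (EuclideanSpace ℝ (Fin d)) M]
  [IsManifold (𝓡 d) ∞ M]

namespace AlmostContactStructure

variable (s : AlmostContactStructure d M)

theorem ξ_ne_zero (x : M) : s.ξ x ≠ 0 := fun h ↦ by simpa [h] using s.η_ξ x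

/-- Since $\varphi^2\xi=0$, evaluating $\varphi^2$ on $\varphi\xi$ shows $\varphi\xi=c\,\xi$.
Applying $\varphi$ again gives $c\,\varphi\xi=0$, and either factor being zero suffices. -/
theorem φ_ξ (x : M) : s.φ x (s.ξ x) = 0 := by
  have h0 : s.φ x (s.φ x (s.ξ x)) = 0 := by simp [s.φ_sq, s.η_ξ]
  have h1 := s.φ_sq x (s.φ x (s.ξ x))
  rw [h0, map_zero] at h1
  have h2 : s.φ x (s.ξ x) = s.η x (s.φ x (s.ξ x)) • s.ξ x :=
    neg_add_eq_zero.mp h1.symm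
  have h3 := congrArg (s.φ x) h2
  rw [h0, map_smul] at h3
  rcases smul_eq_zero.mp h3.symm with h | h
  · rw [h2, h, zero_smul]
  · exact h

/-- Compare $\varphi^2(\varphi v)$ with $\varphi(\varphi^2v)$: they differ by $\eta(\varphi
v)\,\xi$. -/
theorem η_φ (x : M) (v : TangentSpace (𝓡 d) x) : s.η x (s.φ x v) = 0 := by
  have h1 := s.φ_sq x (s.φ x v)
  rw [s.φ_sq x v, map_add, map_neg, map_smul, s.φ_ξ, smul_zero, add_zero, left_eq_add] at h1
  exact (smul_eq_zero.mp h1).resolve_right (s.ξ_ne_zero x)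

theorem smooth_φ_apply {X : ∀ x : M, TangentSpace (𝓡 d) x} (hX : IsSmoothField X) :
    IsSmoothField (fun x ↦ s.φ x (X x)) :=
  s.smooth_φ.clm_bundle_apply hX

end AlmostContactStructure

theorem IsSmoothField.mdifferentiableAt {X : ∀ x : M, TangentSpace (𝓡 d) x} (hX : IsSmoothField X)
    (x : M) : MDifferentiableAt (𝓡 d) (𝓡 d).tangent
      (fun y ↦ (TotalSpace.mk' (EuclideanSpace ℝ (Fin d)) y (X y) : TangentBundle (𝓡 d) M)) x :=
  (hX x).mdifferentiableAt (by simp)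

/-- A local extension is cut off by a bump function. Conditions stated for global smooth fields can
thereby be tested on single vectors. -/
theorem exists_smoothField_eq [T2Space M] {x : M} (v : TangentSpace (𝓡 d) x) :
    ∃ X : ∀ x : M, TangentSpace (𝓡 d) x, IsSmoothField X ∧ X x = v := by
  obtain ⟨s, hs, hsX⟩ := FiberBundle.exists_contMDiffOn_extend (k := ∞) (𝓡 d)
    (EuclideanSpace ℝ (Fin d)) v
  obtain ⟨f, -, hf⟩ := (SmoothBumpFunction.nhds_basis_tsupport (I := 𝓡 d) x).mem_iff.mp
    (interior_mem_nhds.mpr hs)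
  refine ⟨(f : M → ℝ) • FiberBundle.extend (EuclideanSpace ℝ (Fin d)) v, ?_, ?_⟩
  · exact f.contMDiff.contMDiffOn.smul_section_of_tsupport isOpen_interior hf
      (hsX.mono interior_subset)
  · simp

variable [RiemannianBundle (fun x : M ↦ TangentSpace (𝓡 d) x)]

namespace AlmostContactStructure

variable {s : AlmostContactStructure d M}

theorem IsCompatible.inner_ξ (hs : s.IsCompatible) (x : M) (v : TangentSpace (𝓡 d) x) :
    inner ℝ (s.ξ x) v = s.η x v := by
  have h := hs x (s.ξ x) v
  rw [s.φ_ξ, inner_zero_left, s.η_ξ] at h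
  linarith

theorem IsCompatible.inner_φ (hs : s.IsCompatible) (x : M) (u v : TangentSpace (𝓡 d) x) :
    inner ℝ (s.φ x u) v = -inner ℝ u (s.φ x v) := by
  have h := hs x u (s.φ x v)
  rw [s.φ_sq, s.η_φ, inner_add_right, inner_neg_right, inner_smul_right,
    real_inner_comm (s.ξ x) (s.φ x u), hs.inner_ξ, s.η_φ] at h
  linarith

end AlmostContactStructure
end Contact
-- Differences of metric connections with skew torsion.
section Connection

variable {d : ℕ} {M : Type*} [TopologicalSpace M] [ChartedSpace (EuclideanSpace ℝ (Fin d)) M]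
  [IsManifold (𝓡 d) ∞ M] [RiemannianBundle (fun x : M ↦ TangentSpace (𝓡 d) x)]
  {D D' : CovariantDerivative (𝓡 d) (EuclideanSpace ℝ (Fin d)) (TangentSpace (𝓡 d) : M → Type _)}

/-- The difference `g(∇_u V - ∇'_u V, w)` of two connections, as a trilinear form in `u, V, w`. -/
noncomputable def differenceForm
    (D D' : CovariantDerivative (𝓡 d) (EuclideanSpace ℝ (Fin d)) (TangentSpace (𝓡 d) : M → Type _))
    (x : M) (u v w : TangentSpace (𝓡 d) x) : ℝ :=
  inner ℝ (D.difference D' x v u) w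

theorem differenceForm_apply {x : M} {Y : ∀ x : M, TangentSpace (𝓡 d) x}
    (hY : MDifferentiableAt (𝓡 d) (𝓡 d).tangent
      (fun y ↦ (TotalSpace.mk' (EuclideanSpace ℝ (Fin d)) y (Y y) : TangentBundle (𝓡 d) M)) x)
    (u w : TangentSpace (𝓡 d) x) :
    differenceForm D D' x u (Y x) w = inner ℝ (D Y x u) w - inner ℝ (D' Y x u) w := by
  rw [differenceForm, CovariantDerivative.difference,
    IsCovariantDerivativeOn.difference_apply (hσ := hY), ← inner_sub_left]
  rfl

theorem differenceForm_sub (x : M) (u v w : TangentSpace (𝓡 d) x) :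
    differenceForm D D' x u v w - differenceForm D D' x v u w
      = torsionForm D x u v w - torsionForm D' x u v w := by
  have hu := FiberBundle.mdifferentiableAt_extend (𝓡 d) (EuclideanSpace ℝ (Fin d)) u
  have hv := FiberBundle.mdifferentiableAt_extend (𝓡 d) (EuclideanSpace ℝ (Fin d)) v
  have h₁ := D.torsion_apply hu hv
  have h₂ := D'.torsion_apply hu hv
  have h₃ := differenceForm_apply (D := D) (D' := D') hv u w
  have h₄ := differenceForm_apply (D := D) (D' := D') hu v w
  simp only [FiberBundle.extend_apply_self] at h₁ h₂ h₃ h₄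
  rw [torsionForm, torsionForm, h₁, h₂, h₃, h₄]
  simp only [inner_sub_left]
  ring

variable [IsContMDiffRiemannianBundle (𝓡 d) ∞ (EuclideanSpace ℝ (Fin d))
    (fun x : M ↦ TangentSpace (𝓡 d) x)]

set_option synthInstance.maxHeartbeats 200000 in
instance isContMDiffRiemannianBundle_one :
    IsContMDiffRiemannianBundle (𝓡 d) 1 (EuclideanSpace ℝ (Fin d))
      (TangentSpace (𝓡 d) : M → Type _) :=
  IsContMDiffRiemannianBundle.of_le (n := ∞) (by simp)

namespace IsMetricWithSkewTorsion

theorem mvfderiv_inner (hD : IsMetricWithSkewTorsion D) {X Y : ∀ x : M, TangentSpace (𝓡 d) x}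
    (hX : IsSmoothField X) (hY : IsSmoothField Y) (x : M) (v : TangentSpace (𝓡 d) x) :
    mvfderiv (𝓡 d) (fun y ↦ (inner ℝ (X y) (Y y) : ℝ)) x v
      = inner ℝ (D X x v) (Y x) + inner ℝ (X x) (D Y x v) := by
  have h := hD.metric.mvfderiv_inner_eq
    (FiberBundle.extend (EuclideanSpace ℝ (Fin d)) v) (hX.mdifferentiableAt x)
    (hY.mdifferentiableAt x)
  simpa using h

theorem extDeriv₁_eq (hD : IsMetricWithSkewTorsion D) {s : AlmostContactStructure d M}
    (hs : s.IsCompatible) {X Y : ∀ x : M, TangentSpace (𝓡 d) x}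
    (hX : IsSmoothField X) (hY : IsSmoothField Y) (x : M) :
    extDeriv₁ s.η X Y x = inner ℝ (D s.ξ x (X x)) (Y x) - inner ℝ (D s.ξ x (Y x)) (X x)
      + torsionForm D x (X x) (Y x) (s.ξ x) := by
  have hT := D.torsion_apply (hX.mdifferentiableAt x) (hY.mdifferentiableAt x)
  have hη (Z : ∀ x : M, TangentSpace (𝓡 d) x) :
      (fun y ↦ s.η y (Z y)) = fun y ↦ inner ℝ (s.ξ y) (Z y) :=
    funext fun y ↦ (hs.inner_ξ y (Z y)).symm
  rw [extDeriv₁, torsionForm, hT, hη, hη, hD.mvfderiv_inner s.smooth_ξ hY,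
    hD.mvfderiv_inner s.smooth_ξ hX, real_inner_comm (s.ξ x), inner_sub_right, inner_sub_right,
    ← hs.inner_ξ]
  ring

variable (hD : IsMetricWithSkewTorsion D) (hD' : IsMetricWithSkewTorsion D')
include hD hD'

theorem differenceForm_skew₂₃ (x : M) (u v w : TangentSpace (𝓡 d) x) :
    differenceForm D D' x u v w = -differenceForm D D' x u w v := by
  have hv := FiberBundle.mdifferentiableAt_extend (𝓡 d) (EuclideanSpace ℝ (Fin d)) v
  have hw := FiberBundle.mdifferentiableAt_extend (𝓡 d) (EuclideanSpace ℝ (Fin d)) w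
  have h₁ := hD.metric.mvfderiv_inner_eq (FiberBundle.extend (EuclideanSpace ℝ (Fin d)) u) hv hw
  have h₂ := hD'.metric.mvfderiv_inner_eq (FiberBundle.extend (EuclideanSpace ℝ (Fin d)) u) hv hw
  have h₃ := differenceForm_apply (D := D) (D' := D') hv u w
  have h₄ := differenceForm_apply (D := D) (D' := D') hw u v
  simp only [FiberBundle.extend_apply_self] at h₁ h₂ h₃ h₄
  rw [h₁] at h₂
  rw [real_inner_comm v, real_inner_comm v] at h₄
  linarith

/-- Let $B$ be the difference form. In $B(u,v,w)-B(v,u,w)$, which is a difference of torsions and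
hence skew in $v,w$, the terms led by $u$ are already skew in $v,w$ by metricity. So $B(v,u,w)$ is
skew in $v,w$, its outer slots, and with skewness in the last two slots this gives total skewness.
-/
theorem differenceForm_skew₁₂ (x : M) (u v w : TangentSpace (𝓡 d) x) :
    differenceForm D D' x u v w = -differenceForm D D' x v u w := by
  have hB := hD.differenceForm_skew₂₃ hD' x
  have hT := differenceForm_sub (D := D) (D' := D') x
  linarith [hB u v w, hB v u w, hB v w u, hB w u v, hB u w v, hB w v u, hT u v w, hT u w v,
    hT v w u, hD.skew₂₃ x u v w, hD'.skew₂₃ x u v w, hD.skew₁₂ x u v w, hD'.skew₁₂ x u v w,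
    hD.skew₂₃ x v u w, hD'.skew₂₃ x v u w]

theorem torsionForm_sub (x : M) (u v w : TangentSpace (𝓡 d) x) :
    torsionForm D x u v w - torsionForm D' x u v w = 2 * differenceForm D D' x u v w := by
  linarith [differenceForm_sub (D := D) (D' := D') x u v w, hD.differenceForm_skew₁₂ hD' x u v w]

end IsMetricWithSkewTorsion
end Connection
-- Algebra of the 3-form $\eta_j\wedge\Phi_j+\eta_k\wedge\Phi_k$.
namespace AlmostThreeContactMetric

variable {n : ℕ} {M : Type*} [TopologicalSpace M]
  [ChartedSpace (EuclideanSpace ℝ (Fin (4 * n + 3))) M] [IsManifold (𝓡 (4 * n + 3)) ∞ M]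
  [RiemannianBundle (fun x : M ↦ TangentSpace (𝓡 (4 * n + 3)) x)]
  (S : AlmostThreeContactMetric n M)

theorem wedgeSum_skew₁₂ (i : Fin 3) (x : M) (u v w : TangentSpace (𝓡 (4 * n + 3)) x) :
    S.wedgeSum i x u v w = -S.wedgeSum i x v u w := by
  have h (l : Fin 3) (a b : TangentSpace (𝓡 (4 * n + 3)) x) :
      inner ℝ a ((S.str l).φ x b) = -inner ℝ b ((S.str l).φ x a) := by
    rw [← (S.compatible l).inner_φ, real_inner_comm]
  simp only [wedgeSum, wedge₁₂, AlmostContactStructure.fundForm]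
  rw [h _ u v, h _ w u, h _ v w, h _ u v, h _ w u, h _ v w]
  ring

theorem wedgeSum_skew₂₃ (i : Fin 3) (x : M) (u v w : TangentSpace (𝓡 (4 * n + 3)) x) :
    S.wedgeSum i x u v w = -S.wedgeSum i x u w v := by
  have h (l : Fin 3) (a b : TangentSpace (𝓡 (4 * n + 3)) x) :
      inner ℝ a ((S.str l).φ x b) = -inner ℝ b ((S.str l).φ x a) := by
    rw [← (S.compatible l).inner_φ, real_inner_comm]
  simp only [wedgeSum, wedge₁₂, AlmostContactStructure.fundForm]
  rw [h _ u v, h _ w u, h _ v w, h _ u v, h _ w u, h _ v w]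
  ring

theorem wedgeSum_add (i : Fin 3) (x : M) (u u' v w : TangentSpace (𝓡 (4 * n + 3)) x) :
    S.wedgeSum i x (u + u') v w = S.wedgeSum i x u v w + S.wedgeSum i x u' v w := by
  simp only [wedgeSum, wedge₁₂, AlmostContactStructure.fundForm, map_add, inner_add_left,
    inner_add_right]
  ring

theorem wedgeSum_smul (i : Fin 3) (x : M) (a : ℝ) (u v w : TangentSpace (𝓡 (4 * n + 3)) x) :
    S.wedgeSum i x (a • u) v w = a * S.wedgeSum i x u v w := by
  simp only [wedgeSum, wedge₁₂, AlmostContactStructure.fundForm, map_smul, real_inner_smul_left,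
    real_inner_smul_right, smul_eq_mul]
  ring

theorem φ_φ_add_two (i : Fin 3) (x : M) (v : TangentSpace (𝓡 (4 * n + 3)) x) :
    (S.str i).φ x ((S.str (i + 2)).φ x v)
      = -(S.str (i + 1)).φ x v + (S.str (i + 2)).η x v • (S.str i).ξ x := by
  have h := S.φ_eq' (i + 2) x v
  -- The structure equations are used for the cyclic shift $(k,i,j)$ of $(i,j,k)$.
  rw [show i + 2 + 2 = i + 1 by omega, show i + 2 + 1 = i by omega] at h
  rw [h]
  abel

theorem φ_add_two_φ (i : Fin 3) (x : M) (v : TangentSpace (𝓡 (4 * n + 3)) x) :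
    (S.str (i + 2)).φ x ((S.str i).φ x v)
      = (S.str (i + 1)).φ x v + (S.str i).η x v • (S.str (i + 2)).ξ x := by
  have h := S.φ_eq (i + 2) x v
  rw [show i + 2 + 2 = i + 1 by omega, show i + 2 + 1 = i by omega] at h
  rw [h]
  abel

theorem φ_φ_add_one (i : Fin 3) (x : M) (v : TangentSpace (𝓡 (4 * n + 3)) x) :
    (S.str i).φ x ((S.str (i + 1)).φ x v)
      = (S.str (i + 2)).φ x v + (S.str (i + 1)).η x v • (S.str i).ξ x := by
  rw [S.φ_eq]
  abel

theorem φ_add_one_φ (i : Fin 3) (x : M) (v : TangentSpace (𝓡 (4 * n + 3)) x) :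
    (S.str (i + 1)).φ x ((S.str i).φ x v)
      = -(S.str (i + 2)).φ x v + (S.str i).η x v • (S.str (i + 1)).ξ x := by
  rw [S.φ_eq']
  abel

theorem η_add_one_φ (i : Fin 3) (x : M) (v : TangentSpace (𝓡 (4 * n + 3)) x) :
    (S.str (i + 1)).η x ((S.str i).φ x v) = -(S.str (i + 2)).η x v := by
  rw [S.η_eq', neg_neg]

theorem η_add_two_φ (i : Fin 3) (x : M) (v : TangentSpace (𝓡 (4 * n + 3)) x) :
    (S.str (i + 2)).η x ((S.str i).φ x v) = (S.str (i + 1)).η x v := by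
  have h := S.η_eq (i + 2) x v
  rwa [show i + 2 + 2 = i + 1 by omega, show i + 2 + 1 = i by omega, eq_comm] at h

/-- The quaternionic relations turn $j$-terms into $k$-terms and back. Those with $\eta$ evaluated
on `v` or `w` cancel, while those with $\eta$ on `u` double; this is the source of the factor
$\beta/2$ in the theorem. -/
theorem wedgeSum_φ (i : Fin 3) (x : M) (u v w : TangentSpace (𝓡 (4 * n + 3)) x) :
    S.wedgeSum i x u ((S.str i).φ x v) w + S.wedgeSum i x u v ((S.str i).φ x w)
      = -2 * ((S.str (i + 2)).η x u * inner ℝ ((S.str (i + 1)).φ x v) w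
        - (S.str (i + 1)).η x u * inner ℝ ((S.str (i + 2)).φ x v) w) := by
  have hξ (l : Fin 3) (a : TangentSpace (𝓡 (4 * n + 3)) x) :
      inner ℝ a ((S.str l).ξ x) = (S.str l).η x a := by
    rw [real_inner_comm, (S.compatible l).inner_ξ]
  have h (l : Fin 3) (a b : TangentSpace (𝓡 (4 * n + 3)) x) :
      inner ℝ a ((S.str l).φ x b) = -inner ℝ b ((S.str l).φ x a) := by
    rw [← (S.compatible l).inner_φ, real_inner_comm]
  simp only [wedgeSum, wedge₁₂, AlmostContactStructure.fundForm, (S.compatible _).inner_φ,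
    φ_φ_add_two, φ_add_two_φ, φ_φ_add_one, φ_add_one_φ, η_add_one_φ, η_add_two_φ, inner_add_right,
    inner_neg_right, real_inner_smul_right, hξ]
  rw [h _ w u, h _ u v, h _ v w]
  ring

end AlmostThreeContactMetric
-- Horizontal fields, and identification of $\tilde\beta$ with $\beta$.
namespace AlmostThreeContactMetric

variable {n : ℕ} {M : Type*} [TopologicalSpace M]
  [ChartedSpace (EuclideanSpace ℝ (Fin (4 * n + 3))) M] [IsManifold (𝓡 (4 * n + 3)) ∞ M]
  [RiemannianBundle (fun x : M ↦ TangentSpace (𝓡 (4 * n + 3)) x)]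
  {S : AlmostThreeContactMetric n M}

theorem IsHorizontal.φ {X : ∀ x : M, TangentSpace (𝓡 (4 * n + 3)) x} (hX : S.IsHorizontal X)
    (i : Fin 3) : S.IsHorizontal (fun x ↦ (S.str i).φ x (X x)) := by
  refine ⟨(S.str i).smooth_φ_apply hX.1, fun j x ↦ ?_⟩
  obtain rfl | rfl | rfl : j = i ∨ j = i + 1 ∨ j = i + 2 := by omega
  · exact (S.str _).η_φ x _
  · rw [η_add_one_φ, hX.2, neg_zero]
  · rw [η_add_two_φ, hX.2]

variable (S) in
theorem exists_isHorizontal_eq [T2Space M] {x : M} (v : TangentSpace (𝓡 (4 * n + 3)) x)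
    (hv : ∀ i, (S.str i).η x v = 0) :
    ∃ X : ∀ x : M, TangentSpace (𝓡 (4 * n + 3)) x, S.IsHorizontal X ∧ X x = v := by
  -- Each $\varphi_i^2$ annihilates $\xi_i$ and is $-1$ on $\ker\eta_i$, so the product of the three
  -- squares is minus the projection onto $\mathcal H$. Hence the extension of $-v$.
  obtain ⟨X, hX, hXv⟩ := exists_smoothField_eq (-v)
  let P (i : Fin 3) (Y : ∀ x : M, TangentSpace (𝓡 (4 * n + 3)) x) :
      ∀ x : M, TangentSpace (𝓡 (4 * n + 3)) x := fun y ↦ (S.str i).φ y ((S.str i).φ y (Y y))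
  have hP (i : Fin 3) {Y : ∀ x : M, TangentSpace (𝓡 (4 * n + 3)) x} (hY : IsSmoothField Y) :
      IsSmoothField (P i Y) := (S.str i).smooth_φ_apply ((S.str i).smooth_φ_apply hY)
  have h₀ (i : Fin 3) (Y : ∀ x : M, TangentSpace (𝓡 (4 * n + 3)) x) (y : M) :
      (S.str i).η y (P i Y y) = 0 := (S.str i).η_φ y _
  have h₁ (i : Fin 3) (Y : ∀ x : M, TangentSpace (𝓡 (4 * n + 3)) x) (y : M) :
      (S.str (i + 1)).η y (P i Y y) = -(S.str (i + 1)).η y (Y y) := by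
    simp only [P]
    rw [η_add_one_φ, η_add_two_φ]
  have h₂ (i : Fin 3) (Y : ∀ x : M, TangentSpace (𝓡 (4 * n + 3)) x) (y : M) :
      (S.str (i + 2)).η y (P i Y y) = -(S.str (i + 2)).η y (Y y) := by
    simp only [P]
    rw [η_add_two_φ, η_add_one_φ]
  have hPv (i : Fin 3) (Y : ∀ x : M, TangentSpace (𝓡 (4 * n + 3)) x)
      (hY : (S.str i).η x (Y x) = 0) : P i Y x = -Y x := by
    simp [P, (S.str i).φ_sq, hY]
  refine ⟨P 0 (P 1 (P 2 X)), ⟨hP _ (hP _ (hP _ hX)), fun i y ↦ ?_⟩, ?_⟩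
  · fin_cases i
    · exact h₀ 0 _ y
    · refine (h₁ 0 _ y).trans ?_
      exact neg_eq_zero.mpr (h₀ 1 _ y)
    · refine (h₂ 0 _ y).trans (neg_eq_zero.mpr ?_)
      exact (h₁ 1 _ y).trans (neg_eq_zero.mpr (h₀ 2 _ y))
  · have e₂ : P 2 X x = v := by rw [hPv 2 X (by rw [hXv, map_neg, hv, neg_zero]), hXv, neg_neg]
    have e₁ : P 1 (P 2 X) x = -v := by rw [hPv 1 _ (by rw [e₂, hv]), e₂]
    rw [hPv 0 _ (by rw [e₁, map_neg, hv, neg_zero]), e₁, neg_neg]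

variable (S) in
theorem exists_horizontal_ne_zero (hn : 1 ≤ n) (x : M) :
    ∃ v : TangentSpace (𝓡 (4 * n + 3)) x, v ≠ 0 ∧ ∀ i, (S.str i).η x v = 0 := by
  let f : TangentSpace (𝓡 (4 * n + 3)) x →ₗ[ℝ] Fin 3 → ℝ :=
    LinearMap.pi fun i ↦ ((S.str i).η x).toLinearMap
  have hdim : Module.finrank ℝ (Fin 3 → ℝ)
      < Module.finrank ℝ (TangentSpace (𝓡 (4 * n + 3)) x) := by
    change _ < Module.finrank ℝ (EuclideanSpace ℝ (Fin (4 * n + 3)))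
    simp only [Module.finrank_fin_fun, finrank_euclideanSpace_fin]
    omega
  have : FiniteDimensional ℝ (TangentSpace (𝓡 (4 * n + 3)) x) :=
    inferInstanceAs (FiniteDimensional ℝ (EuclideanSpace ℝ (Fin (4 * n + 3))))
  obtain ⟨v, hv, hv0⟩ := (Submodule.ne_bot_iff _).mp
    (LinearMap.ker_ne_bot_of_finrank_lt (f := f) hdim)
  exact ⟨v, hv0, fun i ↦ congrFun (LinearMap.mem_ker.mp hv) i⟩

variable [IsContMDiffRiemannianBundle (𝓡 (4 * n + 3)) ∞ (EuclideanSpace ℝ (Fin (4 * n + 3)))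
      (fun x : M ↦ TangentSpace (𝓡 (4 * n + 3)) x)]
  {D D' : CovariantDerivative (𝓡 (4 * n + 3)) (EuclideanSpace ℝ (Fin (4 * n + 3)))
      (TangentSpace (𝓡 (4 * n + 3)) : M → Type _)}

/-- Brackets and $d\eta_j$ are rewritten through the connection. The torsion terms of the Lie
derivative cancel those of the two $d\eta_j$, by skewness of the torsion and of $\varphi_i$. -/
theorem tensorA_eq (hD : IsMetricWithSkewTorsion D) (i j : Fin 3)
    {X Y : ∀ x : M, TangentSpace (𝓡 (4 * n + 3)) x} (hX : IsSmoothField X) (hY : IsSmoothField Y)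
    (x : M) :
    S.tensorA i j X Y x = inner ℝ (covDerivEndo D (S.str i).φ (S.str j).ξ X x) (Y x)
      - inner ℝ (D (S.str j).ξ x ((S.str i).φ x (Y x))) (X x)
      - inner ℝ (D (S.str j).ξ x (Y x)) ((S.str i).φ x (X x)) := by
  have hφX := (S.str i).smooth_φ_apply hX
  have hφY := (S.str i).smooth_φ_apply hY
  have hξ := (S.str j).smooth_ξ
  have h₁ := D.torsion_apply (hξ.mdifferentiableAt x) (hX.mdifferentiableAt x)
  have h₂ := D.torsion_apply (hξ.mdifferentiableAt x) (hφX.mdifferentiableAt x)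
  have hφ := (S.compatible i).inner_φ x
  have hT₁ (v w : TangentSpace (𝓡 (4 * n + 3)) x) := hD.skew₁₂ x v ((S.str j).ξ x) w
  have hT₂ (v w : TangentSpace (𝓡 (4 * n + 3)) x) := hD.skew₂₃ x v w ((S.str j).ξ x)
  have e₁ : VectorField.mlieBracket (𝓡 (4 * n + 3)) (S.str j).ξ X x
      = D X x ((S.str j).ξ x) - D (S.str j).ξ x (X x) - D.torsion x ((S.str j).ξ x) (X x) := by
    rw [h₁]; abel
  have e₂ : VectorField.mlieBracket (𝓡 (4 * n + 3)) (S.str j).ξ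
        (fun y ↦ (S.str i).φ y (X y)) x
      = D (fun y ↦ (S.str i).φ y (X y)) x ((S.str j).ξ x)
        - D (S.str j).ξ x ((S.str i).φ x (X x))
        - D.torsion x ((S.str j).ξ x) ((S.str i).φ x (X x)) := by
    rw [h₂]; abel
  rw [tensorA, hD.extDeriv₁_eq (S.compatible j) hX hφY, hD.extDeriv₁_eq (S.compatible j) hφX hY,
    lieDerivEndo, covDerivEndo, e₁, e₂, hT₂, hT₂, hT₁, hT₁]
  simp only [map_sub, inner_sub_left, hφ, torsionForm]
  ring

namespace IsCanonicalConnection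

/-- For horizontal `v` one has $\nabla_v\varphi_i=0$, and differentiating $\varphi_i\xi_i=0$ puts
$\nabla_v\xi_i$ in $\ker\varphi_i$, the line of $\xi_i$. Constancy of $|\xi_i|=1$ makes it
orthogonal to $\xi_i$ too. -/
theorem covDeriv_ξ_eq_zero [T2Space M] (hD : S.IsCanonicalConnection D) (i : Fin 3) {x : M}
    (v : TangentSpace (𝓡 (4 * n + 3)) x) (hv : ∀ i, (S.str i).η x v = 0) :
    D (S.str i).ξ x v = 0 := by
  obtain ⟨b, -, hb⟩ := hD.exists_deriv_φ
  obtain ⟨X, hX, rfl⟩ := exists_smoothField_eq v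
  have hξ := (S.str i).smooth_ξ
  have h := hb i X _ hX hξ x
  have h0 : (fun y ↦ (S.str i).φ y ((S.str i).ξ y)) = 0 := funext fun y ↦ (S.str i).φ_ξ y
  rw [hv, hv, zero_smul, zero_smul, sub_zero, smul_zero, covDerivEndo, h0] at h
  simp only [CovariantDerivative.zero, Pi.zero_apply, zero_apply, zero_sub,
    neg_eq_zero] at h
  have h1 := (S.str i).φ_sq x (D (S.str i).ξ x (X x))
  rw [h, map_zero, eq_comm, neg_add_eq_zero] at h1
  have h2 := hD.mvfderiv_inner hξ hξ x (X x)
  have hc : (fun y ↦ (inner ℝ ((S.str i).ξ y) ((S.str i).ξ y) : ℝ)) = fun _ ↦ 1 :=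
    funext fun y ↦ by rw [(S.compatible i).inner_ξ, (S.str i).η_ξ]
  rw [hc, real_inner_comm, (S.compatible i).inner_ξ] at h2
  have h3 : (S.str i).η x (D (S.str i).ξ x (X x)) = 0 := by
    simp [mvfderiv] at h2
    linarith
  rw [h1, h3, zero_smul]

theorem reebKilling_eq [T2Space M] (hn : 1 ≤ n) (hD : S.IsCanonicalConnection D) {β b : M → ℝ}
    (hβ : S.IsReebKillingFunction β)
    (hb : ∀ (i : Fin 3) (X Y : ∀ x : M, TangentSpace (𝓡 (4 * n + 3)) x),
      IsSmoothField X → IsSmoothField Y → ∀ x : M,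
        covDerivEndo D (S.str i).φ X Y x
          = b x • ((S.str (i + 2)).η x (X x) • (S.str (i + 1)).φ x (Y x)
              - (S.str (i + 1)).η x (X x) • (S.str (i + 2)).φ x (Y x))) (x : M) :
    b x = β x := by
  obtain ⟨v, hv0, hv⟩ := S.exists_horizontal_ne_zero hn x
  obtain ⟨Y, hY, rfl⟩ := S.exists_isHorizontal_eq v hv
  -- Taking $X=\varphi_kY$, with $k$ the index `2`, makes $\Phi_k(X,Y)=|\varphi_kY|^2=|Y|^2\ne0$, so
  -- the coefficient can be cancelled.
  have hX := hY.φ 2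
  have h := (hβ.offDiag 0 _ Y hX hY x).1
  rw [tensorA_eq hD.toIsMetricWithSkewTorsion 0 (0 + 1) hX.1 hY.1,
    hD.covDeriv_ξ_eq_zero _ (Y x) hv, hD.covDeriv_ξ_eq_zero _ _ fun i ↦ (hY.φ 0).2 i x,
    hb _ _ _ (S.str _).smooth_ξ hX.1, (S.str _).η_ξ, AlmostContactStructure.fundForm] at h
  have hηξ : (S.str (0 + 2)).η x ((S.str (0 + 1)).ξ x) = 0 := by
    have : (S.str (0 + 1)).ξ x = (S.str (0 + 2)).φ x ((S.str 0).ξ x) := S.ξ_eq 2 x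
    rw [this, (S.str _).η_φ]
  have hYY : (inner ℝ ((S.str 2).φ x (Y x)) ((S.str 2).φ x (Y x)) : ℝ) ≠ 0 := by
    rw [S.compatible, hv, zero_mul, sub_zero]
    exact inner_self_ne_zero.mpr hv0
  rw [hηξ, zero_smul, one_smul, zero_sub, inner_zero_left, inner_zero_left, sub_zero, sub_zero,
    real_inner_smul_left, inner_neg_left, (S.compatible (0 + 2)).inner_φ, neg_neg] at h
  exact mul_right_cancel₀ hYY h

theorem differenceForm_eq [T2Space M] (hn : 1 ≤ n) (hD : S.IsCanonicalConnection D) {β : M → ℝ}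
    (hβ : S.IsReebKillingFunction β) {i : Fin 3} (hD' : (S.str i).IsCharacteristicConnection D')
    (x : M) (u v w : TangentSpace (𝓡 (4 * n + 3)) x) :
    differenceForm D D' x u v w = -(β x / 2 * S.wedgeSum i x u v w) := by
  obtain ⟨b, -, hb⟩ := hD.exists_deriv_φ
  have hbβ := hD.reebKilling_eq hn hβ hb x
  have hm := hD.toIsMetricWithSkewTorsion
  have hm' := hD'.toIsMetricWithSkewTorsion
  -- Skewness of $\varphi_i$ turns the left side into
  -- $g((\nabla_u\varphi_i)v-(\nabla^i_u\varphi_i)v,\,w)$, whose second term vanishes.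
  have key (u v w : TangentSpace (𝓡 (4 * n + 3)) x) :
      differenceForm D D' x u ((S.str i).φ x v) w + differenceForm D D' x u v ((S.str i).φ x w)
        = β x * ((S.str (i + 2)).η x u * inner ℝ ((S.str (i + 1)).φ x v) w
          - (S.str (i + 1)).η x u * inner ℝ ((S.str (i + 2)).φ x v) w) := by
    obtain ⟨X, hX, rfl⟩ := exists_smoothField_eq u
    obtain ⟨Y, hY, rfl⟩ := exists_smoothField_eq v
    have h := hb i X Y hX hY x
    have h' := hD'.parallel_φ X Y hX hY x
    have hφY := (S.str i).smooth_φ_apply hY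
    have h₁ := differenceForm_apply (D := D) (D' := D') (hφY.mdifferentiableAt x) (X x) w
    have h₂ := differenceForm_apply (D := D) (D' := D') (hY.mdifferentiableAt x) (X x)
      ((S.str i).φ x w)
    have h₃ := congrArg (fun a ↦ (inner ℝ a w : ℝ)) h
    have h₄ := congrArg (fun a ↦ (inner ℝ a w : ℝ)) h'
    simp only [covDerivEndo, inner_sub_left, real_inner_smul_left, (S.compatible i).inner_φ,
      inner_zero_left] at h₃ h₄
    rw [h₁, h₂, ← hbβ]
    linarith
  have h := threeForm_eq_zero
    (fun u v w ↦ differenceForm D D' x u v w + β x / 2 * S.wedgeSum i x u v w)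
    (φ := (S.str i).φ x) (η := (S.str i).η x) (ξ := (S.str i).ξ x)
    (fun u u' v w ↦ by
      simp only [differenceForm, map_add, inner_add_left, wedgeSum_add]
      ring)
    (fun a u v w ↦ by
      simp only [differenceForm, map_smul, real_inner_smul_left, wedgeSum_smul]
      ring)
    (fun u v w ↦ by
      linear_combination hm.differenceForm_skew₁₂ hm' x u v w
        + β x / 2 * S.wedgeSum_skew₁₂ i x u v w)
    (fun u v w ↦ by
      linear_combination hm.differenceForm_skew₂₃ hm' x u v w
        + β x / 2 * S.wedgeSum_skew₂₃ i x u v w)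
    ((S.str i).φ_sq x)
    (fun u v w ↦ by
      linear_combination key u v w + β x / 2 * S.wedgeSum_φ i x u v w) u v w
  linarith

end IsCanonicalConnection
end AlmostThreeContactMetric
end AlmostContact

/-! ### Comparison of the canonical and characteristic connections. -/

theorem mainTheorem7 {n : ℕ} (hn : 1 ≤ n) {M : Type*} [TopologicalSpace M] [T2Space M]
    [ChartedSpace (EuclideanSpace ℝ (Fin (4 * n + 3))) M] [IsManifold (𝓡 (4 * n + 3)) ∞ M]
    [RiemannianBundle (fun x : M ↦ TangentSpace (𝓡 (4 * n + 3)) x)]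
    [IsContMDiffRiemannianBundle (𝓡 (4 * n + 3)) ∞ (EuclideanSpace ℝ (Fin (4 * n + 3)))
      (fun x : M ↦ TangentSpace (𝓡 (4 * n + 3)) x)]
    (S : AlmostContact.AlmostThreeContactMetric n M) (hS : S.IsCanonical)
    (β : M → ℝ) (hβ : S.IsReebKillingFunction β)
    (D : CovariantDerivative (𝓡 (4 * n + 3)) (EuclideanSpace ℝ (Fin (4 * n + 3)))
      (TangentSpace (𝓡 (4 * n + 3)) : M → Type _))
    (hD : S.IsCanonicalConnection D)
    (Dc : Fin 3 → CovariantDerivative (𝓡 (4 * n + 3)) (EuclideanSpace ℝ (Fin (4 * n + 3)))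
      (TangentSpace (𝓡 (4 * n + 3)) : M → Type _))
    (hDc : ∀ i, (S.str i).IsCharacteristicConnection (Dc i)) :
    (∀ (i : Fin 3) (x : M) (Y : ∀ x : M, TangentSpace (𝓡 (4 * n + 3)) x)
        (u w : TangentSpace (𝓡 (4 * n + 3)) x),
      MDifferentiableAt (𝓡 (4 * n + 3)) (𝓡 (4 * n + 3)).tangent
        (fun y ↦ (TotalSpace.mk' (EuclideanSpace ℝ (Fin (4 * n + 3))) y (Y y) :
          TangentBundle (𝓡 (4 * n + 3)) M)) x →
      inner ℝ (D Y x u) w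
        = inner ℝ (Dc i Y x u) w - β x / 2 * S.wedgeSum i x u (Y x) w) ∧
    (∀ (i : Fin 3) (x : M) (u v w : TangentSpace (𝓡 (4 * n + 3)) x),
      AlmostContact.torsionForm D x u v w - AlmostContact.torsionForm (Dc i) x u v w
        = -(β x) * S.wedgeSum i x u v w) ∧
    ((∀ x, β x = 0) → ∀ (i : Fin 3) (x : M) (Y : ∀ x : M, TangentSpace (𝓡 (4 * n + 3)) x),
      MDifferentiableAt (𝓡 (4 * n + 3)) (𝓡 (4 * n + 3)).tangent
        (fun y ↦ (TotalSpace.mk' (EuclideanSpace ℝ (Fin (4 * n + 3))) y (Y y) :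
          TangentBundle (𝓡 (4 * n + 3)) M)) x →
      D Y x = Dc i Y x) := by
  have key (i : Fin 3) (x : M) (Y : ∀ x : M, TangentSpace (𝓡 (4 * n + 3)) x)
      (hY : MDifferentiableAt (𝓡 (4 * n + 3)) (𝓡 (4 * n + 3)).tangent
        (fun y ↦ (TotalSpace.mk' (EuclideanSpace ℝ (Fin (4 * n + 3))) y (Y y) :
          TangentBundle (𝓡 (4 * n + 3)) M)) x) (u w : TangentSpace (𝓡 (4 * n + 3)) x) :
      inner ℝ (D Y x u) w = inner ℝ (Dc i Y x u) w - β x / 2 * S.wedgeSum i x u (Y x) w := by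
    have h := hD.differenceForm_eq hn hβ (hDc i) x u (Y x) w
    rw [AlmostContact.differenceForm_apply hY] at h
    linarith
  refine ⟨fun i x Y u w hY ↦ key i x Y hY u w, fun i x u v w ↦ ?_, fun h0 i x Y hY ↦ ?_⟩
  · rw [hD.torsionForm_sub (hDc i).toIsMetricWithSkewTorsion, hD.differenceForm_eq hn hβ (hDc i)]
    ring
  · ext1 u
    refine ext_inner_right ℝ fun w ↦ ?_
    rw [key i x Y hY, h0, zero_div, zero_mul, sub_zero]
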